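/- A monounary algebra is a set $A$ with one operation $f\colon A\to A$. A subalgebra $\mathfrak A\subseteq\mathfrak B$ is large if $\mathfrak B$ is generated by $A\cup\{b\}$ for some $b\in B$. For a class $\mathrm K$ of monounary algebras, consider the network whose vertices are the members of $\mathrm K$, with a red edge between any two isomorphic members and a blue edge between two members whenever one of them is a large subalgebra of the other. The generator distance $\mathsf d(\mathfrak A,\mathfrak B)\in\omega\cup\{\infty\}$ in $\mathrm K$ is the least number of blue edges of a path connecting $\mathfrak A$ and $\mathfrak B$ in this network, and $\infty$ if there is no path. The algebra $\langle A,f\rangle$ is connected if for all $a,b\in A$ there are $k,m\in\omega$ with $f^k(a)=f^m(b)$. A core of a connected algebra is a subalgebra isomorphic to $\langle\omega,x\mapsto x+1\rangle$ or to a cycle of length $n\ge 1$. A tree-algebra is a connected monounary algebra $\mathfrak T=\langle T,f\rangle$ whose core is isomorphic to the cycle of length one, that is, consists of a single element $c$ with $f(c)=c$. Its associated forest-algebra of main subtrees is $\mathfrak F=\langle T\setminus\{c\},g\rangle$, where $g(x)=x$ if $f(x)=c$, and $g(x)=f(x)$ otherwise. Proposition. Let $\mathfrak T_1,\mathfrak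 T_2$ be tree-algebras (finite or infinite) with associated forest-algebras $\mathfrak F_1,\mathfrak F_2$. Then $$\mathsf d(\mathfrak T_1,\mathfrak T_2)=\mathsf d(\mathfrak F_1,\mathfrak F_2),$$ where $\mathsf d$ is the generator distance in the class of all monounary algebras, the empty algebra included. If $\mathfrak T_1$ and $\mathfrak T_2$ have at least two elements each (so that $\mathfrak F_1,\mathfrak F_2$ are nonempty), then the same equality holds for the generator distance in the class of all nonempty monounary algebras. -/

import Mathlib

universe u v

/-- A monounary algebra `⟨A, f⟩`: a set with one unary operation. The empty algebra is a term of
this type; whether it is admitted is decided by the class over which the network is built. -/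
structure MonounaryAlgebra : Type (u + 1) where
  carrier : Type u
  op : carrier → carrier

namespace MonounaryAlgebra

instance : CoeSort MonounaryAlgebra.{u} (Type u) := ⟨MonounaryAlgebra.carrier⟩

/-- Isomorphism of monounary algebras (possibly living in different universes). -/
def Isomorphic (A : MonounaryAlgebra.{u}) (B : MonounaryAlgebra.{v}) : Prop :=
  ∃ e : A ≃ B, ∀ x : A, e (A.op x) = B.op (e x)

/-- A subalgebra, given by its universe: a subset closed under the operation. -/
structure Subuniverse (A : MonounaryAlgebra.{u}) where
  carrier : Set A
  op_mem : ∀ x ∈ carrier, A.op x ∈ carrier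

namespace Subuniverse

variable {A : MonounaryAlgebra.{u}}

/-- A subalgebra, regarded as a monounary algebra. -/
def toAlgebra (S : A.Subuniverse) : MonounaryAlgebra.{u} where
  carrier := S.carrier
  op x := ⟨A.op x.1, S.op_mem x.1 x.2⟩

/-- `⟨X⟩`, the subalgebra generated by `X`: the intersection of all subalgebras containing `X`. -/
def generated (X : Set A) : A.Subuniverse where
  carrier := {x | ∀ S : A.Subuniverse, X ⊆ S.carrier → x ∈ S.carrier}
  op_mem x hx S hS := S.op_mem x (hx S hS)

/-- `S` is a large subalgebra of `A`: for some `b ∈ A`, the set `S ∪ {b}` generates `A`. -/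
def IsLarge (S : A.Subuniverse) : Prop :=
  ∃ b : A, (generated (S.carrier ∪ {b})).carrier = Set.univ

end Subuniverse

/-! ### The network of large embeddings in a class `K`, and the generator distance -/

/-- Blue edges: one of the two algebras is a large subalgebra of the other. -/
def BlueEdge (A B : MonounaryAlgebra.{u}) : Prop :=
  (∃ S : B.Subuniverse, S.IsLarge ∧ A = S.toAlgebra) ∨
    (∃ S : A.Subuniverse, S.IsLarge ∧ B = S.toAlgebra)

/-- `HasPath K A B l`: the network of large embeddings of the class `K` (vertices: the members of
`K`; red edges: isomorphic members; blue edges: as above) has a path from `A` to `B` with exactly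
`l` blue edges. -/
inductive HasPath (K : MonounaryAlgebra.{u} → Prop) :
    MonounaryAlgebra.{u} → MonounaryAlgebra.{u} → ℕ → Prop
  | nil (A : MonounaryAlgebra.{u}) (hA : K A) : HasPath K A A 0
  | red {A B C : MonounaryAlgebra.{u}} {l : ℕ} (p : HasPath K A B l) (hC : K C)
      (e : Isomorphic B C) : HasPath K A C l
  | blue {A B C : MonounaryAlgebra.{u}} {l : ℕ} (p : HasPath K A B l) (hC : K C)
      (e : BlueEdge B C) : HasPath K A C (l + 1)

/-- The generator distance in the class `K`: the least blue-length of a path connecting `A` and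
`B`, and `∞` (the infimum `⊤` of the empty set) if there is no such path. -/
noncomputable def genDist (K : MonounaryAlgebra.{u} → Prop) (A B : MonounaryAlgebra.{u}) : ℕ∞ :=
  sInf {d : ℕ∞ | ∃ l : ℕ, HasPath K A B l ∧ d = l}

/-- The class of all monounary algebras, the empty one included. -/
def AllAlgebras : MonounaryAlgebra.{u} → Prop := fun _ => True

/-- The class of all nonempty monounary algebras. -/
def NonemptyAlgebras : MonounaryAlgebra.{u} → Prop := fun A => Nonempty A

/-! ### Tree-algebras and their associated forest-algebras -/

/-- The natural numbers with the successor operation. -/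
def natAlgebra : MonounaryAlgebra.{0} := ⟨ℕ, fun x => x + 1⟩

/-- The cycle of length `n`, for `n ≠ 0`. -/
def cycleAlgebra (n : ℕ) : MonounaryAlgebra.{0} := ⟨ZMod n, fun x => x + 1⟩

/-- `A` is connected: any two elements have a common iterated image. -/
def Connected (A : MonounaryAlgebra.{u}) : Prop :=
  ∀ a b : A, ∃ k m : ℕ, A.op^[k] a = A.op^[m] b

/-- `C` is a core: a subalgebra isomorphic to the natural numbers with successor or to a cycle. -/
def Subuniverse.IsCore {A : MonounaryAlgebra.{u}} (C : A.Subuniverse) : Prop :=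
  Isomorphic C.toAlgebra natAlgebra ∨ ∃ n : ℕ, n ≠ 0 ∧ Isomorphic C.toAlgebra (cycleAlgebra n)

/-- A tree-algebra: a connected monounary algebra whose core is isomorphic to the one-element
cycle. -/
def IsTree (A : MonounaryAlgebra.{u}) : Prop :=
  A.Connected ∧ ∃ C : A.Subuniverse, C.IsCore ∧ Isomorphic C.toAlgebra (cycleAlgebra 1)

/-- The one-element core of a tree-algebra (its only core). -/
noncomputable def IsTree.core {T : MonounaryAlgebra.{u}} (h : T.IsTree) : T.Subuniverse :=
  h.2.choose

open Classical in
/-- The associated forest-algebra of main subtrees of a tree-algebra `T`: the core element `c` is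
removed together with the arrows arriving at it, and a loop is attached to every other element that
was mapped to `c`. -/
noncomputable def IsTree.forest {T : MonounaryAlgebra.{u}} (h : T.IsTree) :
    MonounaryAlgebra.{u} where
  carrier := {x : T // x ∉ h.core.carrier}
  op x := if hx : T.op x.1 ∈ h.core.carrier then x else ⟨T.op x.1, hx⟩

end MonounaryAlgebra

namespace MonounaryAlgebra

/-! Two constructions, defined on all algebras because the vertices inside a path need be neither
trees nor forests, carry paths to paths that are no longer. `addFix` recovers a tree from its forest
and `removeFix` a forest from its tree, up to isomorphism, so they give the two inequalities. Both
preserve isomorphisms and large embeddings, except that `removeFix` may turn a large embedding into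
an isomorphism, which only shortens the path.

For the nonempty class, a passage `M`, `∅`, `C` has `M` and `C` generated by one element, so it can
be replaced by `M`, `M ⊔ C`, `C` with the same two blue edges. -/

theorem Isomorphic.refl (A : MonounaryAlgebra.{u}) : Isomorphic A A :=
  ⟨Equiv.refl _, fun _ => rfl⟩

theorem Isomorphic.symm {A : MonounaryAlgebra.{u}} {B : MonounaryAlgebra.{v}}
    (h : Isomorphic A B) : Isomorphic B A := by
  obtain ⟨e, he⟩ := h
  exact ⟨e.symm, fun x => by rw [Equiv.symm_apply_eq, he, Equiv.apply_symm_apply]⟩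

theorem isomorphic_of_bijective {A : MonounaryAlgebra.{u}} {B : MonounaryAlgebra.{v}}
    (φ : A → B) (hφ : Function.Bijective φ) (h : ∀ x, φ (A.op x) = B.op (φ x)) :
    Isomorphic A B :=
  ⟨Equiv.ofBijective φ hφ, h⟩

/-- `A` embeds into `B` so that one element generates `B` together with the image. -/
def LargeEmbeds (A B : MonounaryAlgebra.{u}) : Prop :=
  ∃ φ : A → B, Function.Injective φ ∧ (∀ x, φ (A.op x) = B.op (φ x)) ∧
    ∃ b : B, ∀ y : B, y ∈ Set.range φ ∨ ∃ k : ℕ, B.op^[k] b = y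

/-- `A` is generated by one element. -/
def Monogenic (A : MonounaryAlgebra.{u}) : Prop :=
  ∃ b : A, ∀ y : A, ∃ k : ℕ, A.op^[k] b = y

theorem Subuniverse.iterate_mem {A : MonounaryAlgebra.{u}} (S : A.Subuniverse) {x : A}
    (hx : x ∈ S.carrier) (k : ℕ) : A.op^[k] x ∈ S.carrier := by
  induction k with
  | zero => exact hx
  | succ k ih => rw [Function.iterate_succ_apply']; exact S.op_mem _ ih

theorem Subuniverse.IsLarge.largeEmbeds {A : MonounaryAlgebra.{u}} {S : A.Subuniverse}
    (h : S.IsLarge) : LargeEmbeds S.toAlgebra A := by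
  obtain ⟨b, hb⟩ := h
  refine ⟨Subtype.val, Subtype.val_injective, fun _ => rfl, b, fun y => ?_⟩
  -- `S` together with the forward orbit of `b` is already closed.
  let R : A.Subuniverse :=
    { carrier := {y | y ∈ S.carrier ∨ ∃ k : ℕ, A.op^[k] b = y}
      op_mem := by
        rintro x (hx | ⟨k, rfl⟩)
        · exact Or.inl (S.op_mem x hx)
        · exact Or.inr ⟨k + 1, Function.iterate_succ_apply' _ _ _⟩ }
  have hy : y ∈ (generated (S.carrier ∪ {b})).carrier := hb ▸ Set.mem_univ y
  have hR : y ∈ R.carrier := hy R <| by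
    rintro x (hx | rfl)
    · exact Or.inl hx
    · exact Or.inr ⟨0, rfl⟩
  exact hR.imp_left fun hx => ⟨⟨y, hx⟩, rfl⟩

theorem LargeEmbeds.exists_isLarge {A B : MonounaryAlgebra.{u}} (h : LargeEmbeds A B) :
    ∃ S : B.Subuniverse, S.IsLarge ∧ Isomorphic A S.toAlgebra := by
  obtain ⟨φ, hinj, hop, b, hb⟩ := h
  refine ⟨⟨Set.range φ, ?_⟩, ⟨b, ?_⟩, ?_⟩
  · rintro _ ⟨x, rfl⟩
    exact ⟨A.op x, hop x⟩
  · refine Set.eq_univ_of_forall fun y S hS => ?_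
    rcases hb y with hy | ⟨k, rfl⟩
    · exact hS (Or.inl hy)
    · exact S.iterate_mem (hS (Or.inr rfl)) k
  · exact ⟨Equiv.ofInjective φ hinj, fun x => Subtype.ext (hop x)⟩

theorem BlueEdge.largeEmbeds {A B : MonounaryAlgebra.{u}} (h : BlueEdge A B) :
    LargeEmbeds A B ∨ LargeEmbeds B A := by
  rcases h with ⟨S, hS, rfl⟩ | ⟨S, hS, rfl⟩
  · exact Or.inl hS.largeEmbeds
  · exact Or.inr hS.largeEmbeds

/-- A blue edge demands a literal subalgebra; the image of the embedding is one, and the red edge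
between it and the domain is free. -/
theorem HasPath.snoc_largeEmbeds {K : MonounaryAlgebra.{u} → Prop}
    (hK : ∀ {A B : MonounaryAlgebra.{u}}, Isomorphic A B → K A → K B)
    {A B C : MonounaryAlgebra.{u}} {l : ℕ} (p : HasPath K A B l) (hB : K B) (hC : K C)
    (h : LargeEmbeds B C ∨ LargeEmbeds C B) : HasPath K A C (l + 1) := by
  rcases h with h | h
  · obtain ⟨S, hS, e⟩ := h.exists_isLarge
    exact (p.red (hK e hB) e).blue hC (Or.inl ⟨S, hS, rfl⟩)
  · obtain ⟨S, hS, e⟩ := h.exists_isLarge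
    exact (p.blue (hK e hC) (Or.inr ⟨S, hS, rfl⟩)).red hC e.symm

/-! ### Maps of algebras that do not increase the generator distance -/

theorem HasPath.map (Φ : MonounaryAlgebra.{u} → MonounaryAlgebra.{u})
    (hiso : ∀ {A B}, Isomorphic A B → Isomorphic (Φ A) (Φ B))
    (hlarge : ∀ {A B}, LargeEmbeds A B → LargeEmbeds (Φ A) (Φ B) ∨ Isomorphic (Φ A) (Φ B))
    {A B A' : MonounaryAlgebra.{u}} {l : ℕ} (p : HasPath AllAlgebras A B l)
    (hA : Isomorphic A' (Φ A)) : ∃ l' ≤ l, HasPath AllAlgebras A' (Φ B) l' := by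
  induction p with
  | nil _ => exact ⟨0, le_rfl, (HasPath.nil A' trivial).red trivial hA⟩
  | red p _ e ih =>
    obtain ⟨l', hl, q⟩ := ih
    exact ⟨l', hl, q.red trivial (hiso e)⟩
  | blue p _ e ih =>
    obtain ⟨l', hl, q⟩ := ih
    rcases e.largeEmbeds with h | h
    · rcases hlarge h with h | h
      · exact ⟨l' + 1, by omega, q.snoc_largeEmbeds (fun _ _ => trivial) trivial trivial (Or.inl h)⟩
      · exact ⟨l', by omega, q.red trivial h⟩
    · rcases hlarge h with h | h
      · exact ⟨l' + 1, by omega, q.snoc_largeEmbeds (fun _ _ => trivial) trivial trivial (Or.inr h)⟩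
      · exact ⟨l', by omega, q.red trivial h.symm⟩

theorem genDist_le_of_hasPath {K K' : MonounaryAlgebra.{u} → Prop}
    {A B A' B' : MonounaryAlgebra.{u}}
    (h : ∀ l, HasPath K A B l → ∃ l' ≤ l, HasPath K' A' B' l') :
    genDist K' A' B' ≤ genDist K A B := by
  refine le_sInf ?_
  rintro _ ⟨l, p, rfl⟩
  obtain ⟨l', hl, q⟩ := h l p
  have hle : genDist K' A' B' ≤ (l' : ℕ∞) := sInf_le ⟨l', q, rfl⟩
  exact hle.trans (Nat.cast_le.2 hl)

theorem genDist_le_of_map (Φ : MonounaryAlgebra.{u} → MonounaryAlgebra.{u})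
    (hiso : ∀ {A B}, Isomorphic A B → Isomorphic (Φ A) (Φ B))
    (hlarge : ∀ {A B}, LargeEmbeds A B → LargeEmbeds (Φ A) (Φ B) ∨ Isomorphic (Φ A) (Φ B))
    {A B A' B' : MonounaryAlgebra.{u}} (hA : Isomorphic A' (Φ A)) (hB : Isomorphic B' (Φ B)) :
    genDist AllAlgebras A' B' ≤ genDist AllAlgebras A B := by
  refine genDist_le_of_hasPath fun l p => ?_
  obtain ⟨l', hl, q⟩ := p.map Φ hiso hlarge hA
  exact ⟨l', hl, q.red trivial hB.symm⟩

/-! ### Adjoining a fixed point: from forests to trees -/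

open Classical in
/-- Adjoin a new fixed point, to which all old fixed points are sent. -/
noncomputable def addFix (A : MonounaryAlgebra.{u}) : MonounaryAlgebra.{u} where
  carrier := Option A
  op x := x.bind fun a => if A.op a = a then none else some (A.op a)

theorem addFix_op_some_of_eq {A : MonounaryAlgebra.{u}} {a : A} (h : A.op a = a) :
    (addFix A).op (some a) = none := if_pos h

theorem addFix_op_some_of_ne {A : MonounaryAlgebra.{u}} {a : A} (h : A.op a ≠ a) :
    (addFix A).op (some a) = some (A.op a) := if_neg h

/-- An injective homomorphism reflects fixed points, so both sides take the same branch. -/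
theorem addFix_map_op {A B : MonounaryAlgebra.{u}} {φ : A → B} (hφ : Function.Injective φ)
    (hop : ∀ x, φ (A.op x) = B.op (φ x)) (x : addFix A) :
    Option.map φ ((addFix A).op x) = (addFix B).op (Option.map φ x) := by
  cases x with
  | none => rfl
  | some a =>
    by_cases h : A.op a = a
    · have h' : B.op (φ a) = φ a := by rw [← hop, h]
      exact (congrArg (Option.map φ) (addFix_op_some_of_eq h)).trans
        (addFix_op_some_of_eq h').symm
    · have h' : B.op (φ a) ≠ φ a := by rw [← hop]; exact hφ.ne h
      refine (congrArg (Option.map φ) (addFix_op_some_of_ne h)).trans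
        (Eq.trans ?_ (addFix_op_some_of_ne h').symm)
      exact congrArg some (hop a)

theorem Isomorphic.addFix {A B : MonounaryAlgebra.{u}} (h : Isomorphic A B) :
    Isomorphic (addFix A) (addFix B) := by
  obtain ⟨e, he⟩ := h
  exact ⟨Equiv.optionCongr e, addFix_map_op e.injective he⟩

theorem exists_iterate_addFix (A : MonounaryAlgebra.{u}) (b : A) (k : ℕ) :
    ∃ j : ℕ, (addFix A).op^[j] (some b) = some (A.op^[k] b) := by
  induction k with
  | zero => exact ⟨0, rfl⟩
  | succ k ih =>
    obtain ⟨j, hj⟩ := ih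
    rw [Function.iterate_succ_apply']
    by_cases h : A.op (A.op^[k] b) = A.op^[k] b
    -- Once the orbit is stationary `j` must stop growing: one more step would lead to `none`.
    · exact ⟨j, by rw [hj, h]⟩
    · exact ⟨j + 1, (Function.iterate_succ_apply' _ _ _).trans
        ((congrArg _ hj).trans (addFix_op_some_of_ne h))⟩

theorem LargeEmbeds.addFix {A B : MonounaryAlgebra.{u}} (h : LargeEmbeds A B) :
    LargeEmbeds (addFix A) (addFix B) := by
  obtain ⟨φ, hinj, hop, b, hb⟩ := h
  refine ⟨Option.map φ, Option.map_injective hinj, addFix_map_op hinj hop, some b, fun y => ?_⟩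
  cases y with
  | none => exact Or.inl ⟨none, rfl⟩
  | some y =>
    rcases hb y with ⟨x, rfl⟩ | ⟨k, rfl⟩
    · exact Or.inl ⟨some x, rfl⟩
    · exact Or.inr (exists_iterate_addFix B b k)

/-! ### Removing the fixed points: from trees to forests -/

open Classical in
/-- Remove all fixed points, and fix every other element that was sent to one of them. -/
noncomputable def removeFix (A : MonounaryAlgebra.{u}) : MonounaryAlgebra.{u} where
  carrier := {x : A // A.op x ≠ x}
  op x := if hx : A.op (A.op x.1) = A.op x.1 then x else ⟨A.op x.1, hx⟩

theorem removeFix_op_of_eq {A : MonounaryAlgebra.{u}} {x : removeFix A}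
    (h : A.op (A.op x.1) = A.op x.1) : (removeFix A).op x = x := dif_pos h

theorem removeFix_op_of_ne {A : MonounaryAlgebra.{u}} {x : removeFix A}
    (h : A.op (A.op x.1) ≠ A.op x.1) : ((removeFix A).op x).1 = A.op x.1 :=
  congrArg Subtype.val (dif_neg h)

theorem op_ne_of_injective {A B : MonounaryAlgebra.{u}} {φ : A → B} (hφ : Function.Injective φ)
    (hop : ∀ x, φ (A.op x) = B.op (φ x)) {x : A} (h : A.op x ≠ x) : B.op (φ x) ≠ φ x := by
  rw [← hop]; exact hφ.ne h

/-- The restriction of an embedding to the elements that are not fixed. -/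
def removeFixMap {A B : MonounaryAlgebra.{u}} (φ : A → B) (hφ : Function.Injective φ)
    (hop : ∀ x, φ (A.op x) = B.op (φ x)) (x : removeFix A) : removeFix B :=
  ⟨φ x.1, op_ne_of_injective hφ hop x.2⟩

theorem removeFixMap_injective {A B : MonounaryAlgebra.{u}} {φ : A → B}
    (hφ : Function.Injective φ) (hop : ∀ x, φ (A.op x) = B.op (φ x)) :
    Function.Injective (removeFixMap φ hφ hop) :=
  fun _ _ h => Subtype.ext (hφ (congrArg Subtype.val h))

theorem removeFixMap_op {A B : MonounaryAlgebra.{u}} {φ : A → B}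
    (hφ : Function.Injective φ) (hop : ∀ x, φ (A.op x) = B.op (φ x)) (x : removeFix A) :
    removeFixMap φ hφ hop ((removeFix A).op x) = (removeFix B).op (removeFixMap φ hφ hop x) := by
  by_cases h : A.op (A.op x.1) = A.op x.1
  · have h' : B.op (B.op (removeFixMap φ hφ hop x).1) = B.op (removeFixMap φ hφ hop x).1 := by
      change B.op (B.op (φ x.1)) = B.op (φ x.1)
      rw [← hop, ← hop, h]
    rw [removeFix_op_of_eq h, removeFix_op_of_eq h']
  · have h' : B.op (B.op (removeFixMap φ hφ hop x).1) ≠ B.op (removeFixMap φ hφ hop x).1 := by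
      change B.op (B.op (φ x.1)) ≠ B.op (φ x.1)
      rw [← hop]; exact op_ne_of_injective hφ hop h
    refine Subtype.ext ?_
    rw [removeFix_op_of_ne h']
    exact (congrArg φ (removeFix_op_of_ne h)).trans (hop _)

theorem removeFixMap_surjective {A B : MonounaryAlgebra.{u}} {φ : A → B}
    (hφ : Function.Injective φ) (hop : ∀ x, φ (A.op x) = B.op (φ x))
    (h : ∀ y : B, B.op y ≠ y → y ∈ Set.range φ) :
    Function.Surjective (removeFixMap φ hφ hop) := by
  rintro ⟨y, hy⟩
  obtain ⟨x, rfl⟩ := h y hy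
  exact ⟨⟨x, fun hx => hy (by rw [← hop, hx])⟩, rfl⟩

theorem Isomorphic.removeFix {A B : MonounaryAlgebra.{u}} (h : Isomorphic A B) :
    Isomorphic (removeFix A) (removeFix B) := by
  obtain ⟨e, he⟩ := h
  exact isomorphic_of_bijective _ ⟨removeFixMap_injective e.injective he,
    removeFixMap_surjective e.injective he fun y _ => e.surjective y⟩
    (removeFixMap_op e.injective he)

theorem exists_iterate_removeFix {A : MonounaryAlgebra.{u}} (b : removeFix A) (k : ℕ)
    (hk : A.op (A.op^[k] b.1) ≠ A.op^[k] b.1) :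
    ∃ j : ℕ, ((removeFix A).op^[j] b).1 = A.op^[k] b.1 := by
  induction k with
  | zero => exact ⟨0, rfl⟩
  | succ k ih =>
    rw [Function.iterate_succ_apply'] at hk ⊢
    -- A fixed `k`-th iterate would make the next one fixed, so the orbit has met no removed element
    -- so far.
    obtain ⟨j, hj⟩ := ih fun h => hk (congrArg A.op h)
    rw [← hj] at hk ⊢
    exact ⟨j + 1, by rw [Function.iterate_succ_apply', removeFix_op_of_ne hk]⟩

/-- A fixed generator contributes only itself to `B` and is then removed, which leaves an
isomorphism. Otherwise it survives and still generates. -/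
theorem LargeEmbeds.removeFix {A B : MonounaryAlgebra.{u}} (h : LargeEmbeds A B) :
    LargeEmbeds (removeFix A) (removeFix B) ∨ Isomorphic (removeFix A) (removeFix B) := by
  obtain ⟨φ, hinj, hop, b, hb⟩ := h
  by_cases hfix : B.op b = b
  · refine Or.inr (isomorphic_of_bijective _ ⟨removeFixMap_injective hinj hop,
      removeFixMap_surjective hinj hop fun y hy => (hb y).resolve_right ?_⟩
      (removeFixMap_op hinj hop))
    rintro ⟨k, rfl⟩
    rw [Function.iterate_fixed hfix] at hy
    exact hy hfix
  · refine Or.inl ⟨_, removeFixMap_injective hinj hop, removeFixMap_op hinj hop, ⟨b, hfix⟩, ?_⟩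
    rintro ⟨y, hy⟩
    rcases hb y with ⟨x, rfl⟩ | ⟨k, rfl⟩
    · exact Or.inl ⟨⟨x, fun hx => hy (by rw [← hop, hx])⟩, rfl⟩
    · obtain ⟨j, hj⟩ := exists_iterate_removeFix (A := B) ⟨b, hfix⟩ k hy
      exact Or.inr ⟨j, Subtype.ext hj⟩

/-! ### Tree-algebras -/

theorem IsTree.exists_core_eq {T : MonounaryAlgebra.{u}} (h : T.IsTree) :
    ∃ c : T, h.core.carrier = {c} ∧ ∀ x : T, T.op x = x ↔ x = c := by
  obtain ⟨e, -⟩ := h.2.choose_spec.2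
  let z : ZMod 1 := 0
  have hsub : ∀ x y : ZMod 1, x = y := fun _ _ => Subsingleton.elim _ _
  obtain ⟨c, hc⟩ : h.core.toAlgebra := e.symm z
  have hcore : h.core.carrier = {c} := Set.eq_singleton_iff_unique_mem.2
    ⟨hc, fun x hx => congrArg Subtype.val (e.injective (hsub (e ⟨x, hx⟩) (e ⟨c, hc⟩)))⟩
  have hfix : T.op c = c := by
    have := h.core.op_mem c hc
    rwa [hcore] at this
  refine ⟨c, hcore, fun x => ⟨fun hx => ?_, fun hx => hx ▸ hfix⟩⟩
  -- Connectedness identifies any two fixed points.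
  obtain ⟨k, m, hkm⟩ := h.1 x c
  rwa [Function.iterate_fixed hx, Function.iterate_fixed hfix] at hkm

theorem IsTree.mem_core_iff {T : MonounaryAlgebra.{u}} (h : T.IsTree) (x : T) :
    x ∈ h.core.carrier ↔ T.op x = x := by
  obtain ⟨c, hc, hfix⟩ := h.exists_core_eq
  rw [hc, hfix, Set.mem_singleton_iff]

theorem IsTree.forest_op_of_mem {T : MonounaryAlgebra.{u}} (h : T.IsTree) {x : h.forest}
    (hx : T.op x.1 ∈ h.core.carrier) : h.forest.op x = x := dif_pos hx

theorem IsTree.forest_op_of_notMem {T : MonounaryAlgebra.{u}} (h : T.IsTree) {x : h.forest}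
    (hx : T.op x.1 ∉ h.core.carrier) : (h.forest.op x).1 = T.op x.1 :=
  congrArg Subtype.val (dif_neg hx)

theorem IsTree.isomorphic_removeFix {T : MonounaryAlgebra.{u}} (h : T.IsTree) :
    Isomorphic h.forest (removeFix T) := by
  refine ⟨Equiv.subtypeEquivRight fun x => not_congr (h.mem_core_iff x), fun x => ?_⟩
  refine Subtype.ext ?_
  by_cases hx : T.op x.1 ∈ h.core.carrier
  · rw [h.forest_op_of_mem hx]
    exact (congrArg Subtype.val (removeFix_op_of_eq ((h.mem_core_iff _).1 hx))).symm
  · have hne : T.op (T.op x.1) ≠ T.op x.1 := fun h' => hx ((h.mem_core_iff _).2 h')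
    exact (h.forest_op_of_notMem hx).trans
      (removeFix_op_of_ne (x := ⟨x.1, fun h' => x.2 ((h.mem_core_iff _).2 h')⟩) hne).symm

theorem IsTree.isomorphic_addFix_forest {T : MonounaryAlgebra.{u}} (h : T.IsTree) :
    Isomorphic T (addFix h.forest) := by
  obtain ⟨c, hc, hfix⟩ := h.exists_core_eq
  have hmem : ∀ x : T, x ∈ h.core.carrier ↔ x = c := fun x => by
    rw [hc, Set.mem_singleton_iff]
  let φ : addFix h.forest → T := fun x => Option.elim x c Subtype.val
  refine (isomorphic_of_bijective φ ⟨?_, ?_⟩ ?_).symm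
  · rintro (_ | x) (_ | y) hxy
    · rfl
    · exact absurd ((hmem _).2 hxy.symm) y.2
    · exact absurd ((hmem _).2 hxy) x.2
    · exact congrArg some (Subtype.ext hxy)
  · intro y
    by_cases hy : y ∈ h.core.carrier
    · exact ⟨none, ((hmem y).1 hy).symm⟩
    · exact ⟨some ⟨y, hy⟩, rfl⟩
  · rintro (_ | x)
    · exact ((hfix c).2 rfl).symm
    · by_cases hx : T.op x.1 ∈ h.core.carrier
      · exact (congrArg φ (addFix_op_some_of_eq (h.forest_op_of_mem hx))).trans
          ((hmem _).1 hx).symm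
      · have hne : h.forest.op x ≠ x := fun h' => x.2 <| (h.mem_core_iff _).2 <|
          (h.forest_op_of_notMem hx).symm.trans (congrArg Subtype.val h')
        exact (congrArg φ (addFix_op_some_of_ne hne)).trans (h.forest_op_of_notMem hx)

theorem IsTree.nonempty_forest {T : MonounaryAlgebra.{u}} (h : T.IsTree) [Nontrivial T] :
    Nonempty h.forest := by
  obtain ⟨c, hc, -⟩ := h.exists_core_eq
  obtain ⟨x, hx⟩ := exists_ne c
  exact ⟨⟨x, by rwa [hc]⟩⟩

/-! ### Avoiding the empty algebra -/

/-- The disjoint union of two algebras. -/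
def sum (A B : MonounaryAlgebra.{u}) : MonounaryAlgebra.{u} where
  carrier := A ⊕ B
  op := Sum.map A.op B.op

theorem Monogenic.largeEmbeds_sum_left {B : MonounaryAlgebra.{u}} (h : Monogenic B)
    (A : MonounaryAlgebra.{u}) : LargeEmbeds A (sum A B) := by
  obtain ⟨b, hb⟩ := h
  refine ⟨Sum.inl, Sum.inl_injective, fun _ => rfl, Sum.inr b, ?_⟩
  rintro (y | y)
  · exact Or.inl ⟨y, rfl⟩
  · obtain ⟨k, rfl⟩ := hb y
    exact Or.inr ⟨k, ((show Function.Semiconj Sum.inr B.op (sum A B).op from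
      fun _ => rfl).iterate_right k b).symm⟩

theorem Monogenic.largeEmbeds_sum_right {A : MonounaryAlgebra.{u}} (h : Monogenic A)
    (B : MonounaryAlgebra.{u}) : LargeEmbeds B (sum A B) := by
  obtain ⟨a, ha⟩ := h
  refine ⟨Sum.inr, Sum.inr_injective, fun _ => rfl, Sum.inl a, ?_⟩
  rintro (y | y)
  · obtain ⟨k, rfl⟩ := ha y
    exact Or.inr ⟨k, ((show Function.Semiconj Sum.inl A.op (sum A B).op from
      fun _ => rfl).iterate_right k a).symm⟩
  · exact Or.inl ⟨y, rfl⟩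

theorem LargeEmbeds.monogenic {A B : MonounaryAlgebra.{u}} [IsEmpty A] (h : LargeEmbeds A B) :
    Monogenic B := by
  obtain ⟨φ, -, -, b, hb⟩ := h
  exact ⟨b, fun y => (hb y).resolve_left fun ⟨x, _⟩ => isEmptyElim x⟩

theorem LargeEmbeds.nonempty {A B : MonounaryAlgebra.{u}} (h : LargeEmbeds A B) : Nonempty B := by
  obtain ⟨-, -, -, b, -⟩ := h
  exact ⟨b⟩

theorem Isomorphic.nonempty {A B : MonounaryAlgebra.{u}} (h : Isomorphic A B)
    (hA : NonemptyAlgebras A) : NonemptyAlgebras B := by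
  obtain ⟨e, -⟩ := h
  exact hA.map e

/-- Invariant for the induction: while the path rests at an empty algebra, the new path waits at the
monogenic `M` visited just before, with one blue edge in reserve. -/
theorem HasPath.nonempty_or {A B : MonounaryAlgebra.{u}} {l : ℕ}
    (p : HasPath AllAlgebras A B l) (hA : Nonempty A) :
    (Nonempty B ∧ ∃ l' ≤ l, HasPath NonemptyAlgebras A B l') ∨
      (IsEmpty B ∧ ∃ M : MonounaryAlgebra.{u}, Monogenic M ∧ ∃ l' : ℕ, l' + 1 ≤ l ∧
        HasPath NonemptyAlgebras A M l') := by
  induction p with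
  | nil _ => exact Or.inl ⟨hA, 0, le_rfl, HasPath.nil A hA⟩
  | red p _ e ih =>
    rcases ih with ⟨hB, l', hl, q⟩ | ⟨hB, M, hM, l', hl, q⟩
    · exact Or.inl ⟨e.nonempty hB, l', hl, q.red (e.nonempty hB) e⟩
    · obtain ⟨e, -⟩ := e
      exact Or.inr ⟨e.symm.isEmpty, M, hM, l', hl, q⟩
  | @blue B C l p _ e ih =>
    rcases ih with ⟨hB, l', hl, q⟩ | ⟨hB, M, hM, l', hl, q⟩
    · rcases isEmpty_or_nonempty C with hC | hC
      · have h : LargeEmbeds C B := e.largeEmbeds.resolve_left fun h =>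
          not_nonempty_iff.2 hC h.nonempty
        exact Or.inr ⟨hC, B, h.monogenic, l', by omega, q⟩
      · exact Or.inl ⟨hC, l' + 1, by omega,
          q.snoc_largeEmbeds Isomorphic.nonempty hB hC e.largeEmbeds⟩
    · have h : LargeEmbeds B C := e.largeEmbeds.resolve_right fun h =>
        not_nonempty_iff.2 hB h.nonempty
      have hMne : NonemptyAlgebras M := ⟨hM.choose⟩
      have hsum := hM.largeEmbeds_sum_right C
      -- The reserved edge and the present one pay for the two edges through `sum M C`.
      exact Or.inl ⟨h.nonempty, l' + 1 + 1, by omega,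
        (q.snoc_largeEmbeds Isomorphic.nonempty hMne hsum.nonempty
          (Or.inl (h.monogenic.largeEmbeds_sum_left M))).snoc_largeEmbeds
            Isomorphic.nonempty hsum.nonempty h.nonempty (Or.inr hsum)⟩

theorem HasPath.all {K : MonounaryAlgebra.{u} → Prop} {A B : MonounaryAlgebra.{u}} {l : ℕ}
    (p : HasPath K A B l) : HasPath AllAlgebras A B l := by
  induction p with
  | nil _ => exact HasPath.nil _ trivial
  | red _ _ e ih => exact ih.red trivial e
  | blue _ _ e ih => exact ih.blue trivial e

theorem genDist_nonemptyAlgebras {A B : MonounaryAlgebra.{u}} (hA : Nonempty A)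
    (hB : Nonempty B) : genDist NonemptyAlgebras A B = genDist AllAlgebras A B := by
  refine le_antisymm (genDist_le_of_hasPath fun l p => ?_)
    (genDist_le_of_hasPath fun l p => ⟨l, le_rfl, p.all⟩)
  rcases p.nonempty_or hA with ⟨-, h⟩ | ⟨h, -⟩
  · exact h
  · exact absurd hB (not_nonempty_iff.2 h)

end MonounaryAlgebra

theorem mainTheorem3 (T₁ T₂ : MonounaryAlgebra.{u}) (h₁ : T₁.IsTree) (h₂ : T₂.IsTree) :
    MonounaryAlgebra.genDist MonounaryAlgebra.AllAlgebras T₁ T₂ =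
        MonounaryAlgebra.genDist MonounaryAlgebra.AllAlgebras h₁.forest h₂.forest ∧
      (Nontrivial T₁ → Nontrivial T₂ →
        MonounaryAlgebra.genDist MonounaryAlgebra.NonemptyAlgebras T₁ T₂ =
          MonounaryAlgebra.genDist MonounaryAlgebra.NonemptyAlgebras h₁.forest h₂.forest) := by
  have hall : MonounaryAlgebra.genDist MonounaryAlgebra.AllAlgebras T₁ T₂ =
      MonounaryAlgebra.genDist MonounaryAlgebra.AllAlgebras h₁.forest h₂.forest :=
    le_antisymm
      (MonounaryAlgebra.genDist_le_of_map MonounaryAlgebra.addFix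
        MonounaryAlgebra.Isomorphic.addFix (fun h => Or.inl h.addFix)
        h₁.isomorphic_addFix_forest h₂.isomorphic_addFix_forest)
      (MonounaryAlgebra.genDist_le_of_map MonounaryAlgebra.removeFix
        MonounaryAlgebra.Isomorphic.removeFix MonounaryAlgebra.LargeEmbeds.removeFix
        h₁.isomorphic_removeFix h₂.isomorphic_removeFix)
  refine ⟨hall, fun _ _ => ?_⟩
  rw [MonounaryAlgebra.genDist_nonemptyAlgebras inferInstance inferInstance, hall,
    MonounaryAlgebra.genDist_nonemptyAlgebras h₁.nonempty_forest h₂.nonempty_forest]
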